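/- An (abstract) operator space is a complex vector space $X$ with norms $\mathcal{O}_n$ on the matrix spaces $\mathbb{M}_n(X)$ such that $\mathcal{O}_{m+n}(x\oplus y)=\max\{\mathcal{O}_m(x),\mathcal{O}_n(y)\}$ and $\mathcal{O}_n(axb)\le\|a\|\,\mathcal{O}_m(x)\,\|b\|$ for $x\in\mathbb{M}_m(X)$, $y\in\mathbb{M}_n(X)$, $a\in\mathbb{M}_{n,m}(\mathbb{C})$, $b\in\mathbb{M}_{m,n}(\mathbb{C})$. Its maximal numerical radius norm is defined, for $x\in\mathbb{M}_n(X)$, by $$\mathcal{W}_{\max}(x)=\inf\Big\{\tfrac12\|aa^*+b^*b\| \;:\; x=ayb,\ a\in\mathbb{M}_{n,r}(\mathbb{C}),\ y\in\mathbb{M}_r(X),\ b\in\mathbb{M}_{r,n}(\mathbb{C}),\ \mathcal{O}_r(y)=1,\ r\in\mathbb{N}\Big\}.$$ Let $\mathbb{C}1$ be the one-dimensional operator space, i.e. $\mathbb{C}$ with the usual operator norm $\|\cdot\|$ on each $\mathbb{M}_n(\mathbb{C})=\mathbb{B}(\mathbb{C}^n)$, and let $w(\alpha)=\sup\{|(\alpha\xi\,|\,\xi)|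 : \xi\in\mathbb{C}^n,\ \|\xi\|=1\}$ be the numerical radius of $\alpha\in\mathbb{M}_n(\mathbb{C})$. Then for every $n\ge1$ and every $\alpha\in\mathbb{M}_n(\mathbb{C})=\mathbb{M}_n(\mathbb{C}1)$: (1) $\mathcal{W}_{\max}(\alpha)=w(\alpha)$. (2) $w(\alpha)=\inf\{\tfrac12\|\beta\beta^*+\gamma^*\gamma\| : \alpha=\beta y\gamma,\ \|y\|=1,\ \beta,y,\gamma\in\mathbb{M}_n(\mathbb{C})\}$. (3) (Ando's theorem in finite dimensions) The following are equivalent: (a) $w(\alpha)\le1$; (b) there are $A,B\in\mathbb{M}_n(\mathbb{C})$ with $A=A^*$, $\|A\|\le1$, $\|B\|\le1$ and $\alpha=(1+A)^{1/2}B(1-A)^{1/2}$; (c) there is $A=A^*\in\mathbb{M}_n(\mathbb{C})$ such that $\begin{bmatrix}1+A&\alpha\\ \alpha^*&1-A\end{bmatrix}$ is positive semidefinite; (d) there is $C\in\mathbb{M}_n(\mathbb{C})$ with $\|C\|\le1$ and $\alpha=2(1-C^*C)^{1/2}C$. -/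

import Mathlib

open scoped Matrix MatrixOrder ComplexOrder Matrix.Norms.L2Operator

/- With these scopes open, `‖A‖` of a complex matrix is its operator norm between Euclidean
spaces and `A ≤ B` is the Loewner order. -/

/-- The product `a x b` of a scalar matrix `a`, a matrix `x` over a complex vector space `X`,
and a scalar matrix `b`. -/
def scalarSandwich {X : Type*} [AddCommGroup X] [Module ℂ X] {l m n p : Type*}
    [Fintype m] [Fintype n] (a : Matrix l m ℂ) (x : Matrix m n X) (b : Matrix n p ℂ) :
    Matrix l p X :=
  Matrix.of fun i j => ∑ k, ∑ k', (a i k * b k' j) • x k k'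

/-- The direct sum `x ⊕ y` in `M_{m+n}(X)`. -/
def matrixDirectSum {X : Type*} [Zero X] {m n : ℕ}
    (x : Matrix (Fin m) (Fin m) X) (y : Matrix (Fin n) (Fin n) X) :
    Matrix (Fin (m + n)) (Fin (m + n)) X :=
  Matrix.reindex finSumFinEquiv finSumFinEquiv (Matrix.fromBlocks x 0 0 y)

/-- An (abstract) operator space structure on a complex vector space `X`: a sequence of norms
on the matrix spaces `M_n(X)` which satisfies Ruan's two axioms. -/
structure OperatorSpace (X : Type*) [AddCommGroup X] [Module ℂ X] where
  /-- the norm on `M_n(X)` -/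
  matNorm : (n : ℕ) → Seminorm ℂ (Matrix (Fin n) (Fin n) X)
  eq_zero_of_matNorm_eq_zero : ∀ (n : ℕ) (x : Matrix (Fin n) (Fin n) X),
    matNorm n x = 0 → x = 0
  matNorm_directSum : ∀ (m n : ℕ) (x : Matrix (Fin m) (Fin m) X) (y : Matrix (Fin n) (Fin n) X),
    matNorm (m + n) (matrixDirectSum x y) = max (matNorm m x) (matNorm n y)
  matNorm_sandwich_le : ∀ (m n : ℕ) (a : Matrix (Fin n) (Fin m) ℂ)
    (x : Matrix (Fin m) (Fin m) X) (b : Matrix (Fin m) (Fin n) ℂ),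
    matNorm n (scalarSandwich a x b) ≤ ‖a‖ * matNorm m x * ‖b‖

/-- The maximal numerical radius norm on `M_n(X)` of an operator space `X`: the infimum of
`½ ‖a a* + b* b‖` over all factorizations `x = a y b` through some `M_r(X)` in which `y` has
norm `1`. -/
noncomputable def OperatorSpace.wMax {X : Type*} [AddCommGroup X] [Module ℂ X]
    (O : OperatorSpace X) {n : ℕ} (x : Matrix (Fin n) (Fin n) X) : ℝ :=
  sInf {t : ℝ | ∃ (r : ℕ) (a : Matrix (Fin n) (Fin r) ℂ) (y : Matrix (Fin r) (Fin r) X)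
    (b : Matrix (Fin r) (Fin n) ℂ),
    x = scalarSandwich a y b ∧ O.matNorm r y = 1 ∧ t = 1 / 2 * ‖a * aᴴ + bᴴ * b‖}

/-- The numerical radius of a bounded operator on a complex Hilbert space. -/
noncomputable def numericalRadius {H : Type*} [NormedAddCommGroup H] [InnerProductSpace ℂ H]
    (T : H →L[ℂ] H) : ℝ :=
  sSup {t : ℝ | ∃ ξ : H, ‖ξ‖ = 1 ∧ t = ‖inner ℂ ξ (T ξ)‖}

/-- The numerical radius of a complex matrix, as an operator on the Euclidean space `ℂⁿ`. -/
noncomputable def matrixNumericalRadius {n : ℕ} (α : Matrix (Fin n) (Fin n) ℂ) : ℝ :=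
  numericalRadius (Matrix.toEuclideanCLM (n := Fin n) (𝕜 := ℂ) α)

theorem scalarSandwich_complex {l m n p : Type*} [Fintype m] [Fintype n]
    (a : Matrix l m ℂ) (x : Matrix m n ℂ) (b : Matrix n p ℂ) :
    scalarSandwich a x b = a * x * b := by
  ext i j
  simp only [scalarSandwich, Matrix.of_apply, Matrix.mul_apply, smul_eq_mul, Finset.sum_mul]
  rw [Finset.sum_comm]
  refine Finset.sum_congr rfl fun k _ => Finset.sum_congr rfl fun k' _ => ?_
  ring

theorem matrixDirectSum_mulVec {m n : ℕ} (x : Matrix (Fin m) (Fin m) ℂ)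
    (y : Matrix (Fin n) (Fin n) ℂ) (v : Fin (m + n) → ℂ) :
    matrixDirectSum x y *ᵥ v =
      Fin.append (x *ᵥ fun i => v (Fin.castAdd n i)) (y *ᵥ fun i => v (Fin.natAdd m i)) := by
  ext i
  refine Fin.addCases (fun i => ?_) (fun i => ?_) i <;>
    simp [matrixDirectSum, Matrix.mulVec, dotProduct, Fin.sum_univ_add]

theorem sq_norm_append {m n : ℕ} (u : Fin m → ℂ) (v : Fin n → ℂ) :
    ‖WithLp.toLp 2 (Fin.append u v)‖ ^ 2 = ‖WithLp.toLp 2 u‖ ^ 2 + ‖WithLp.toLp 2 v‖ ^ 2 := by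
  simp [EuclideanSpace.norm_sq_eq, Fin.sum_univ_add]

theorem l2_norm_le_of_mulVec {n : ℕ} (x : Matrix (Fin n) (Fin n) ℂ) (c : ℝ) (hc : 0 ≤ c)
    (h : ∀ v : Fin n → ℂ, ‖WithLp.toLp 2 (x *ᵥ v)‖ ≤ c * ‖WithLp.toLp 2 v‖) : ‖x‖ ≤ c := by
  rw [← Matrix.l2_opNorm_toEuclideanCLM]
  exact ContinuousLinearMap.opNorm_le_bound _ hc fun v => h v.ofLp

theorem l2_norm_matrixDirectSum {m n : ℕ}
    (x : Matrix (Fin m) (Fin m) ℂ) (y : Matrix (Fin n) (Fin n) ℂ) :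
    ‖matrixDirectSum x y‖ = max ‖x‖ ‖y‖ := by
  have key : ∀ v : Fin (m + n) → ℂ, ‖WithLp.toLp 2 (matrixDirectSum x y *ᵥ v)‖ ^ 2 =
      ‖WithLp.toLp 2 (x *ᵥ fun i => v (Fin.castAdd n i))‖ ^ 2 +
        ‖WithLp.toLp 2 (y *ᵥ fun i => v (Fin.natAdd m i))‖ ^ 2 := fun v => by
    rw [matrixDirectSum_mulVec, sq_norm_append]
  have hM : 0 ≤ max ‖x‖ ‖y‖ := (norm_nonneg x).trans (le_max_left _ _)
  refine le_antisymm ?_ (max_le ?_ ?_)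
  · refine l2_norm_le_of_mulVec _ _ hM fun v => ?_
    refine le_of_sq_le_sq ?_ (mul_nonneg hM (norm_nonneg _))
    have h1 := (Matrix.l2_opNorm_mulVec x (WithLp.toLp 2 fun i => v (Fin.castAdd n i))).trans
      (mul_le_mul_of_nonneg_right (le_max_left ‖x‖ ‖y‖) (norm_nonneg _))
    have h2 := (Matrix.l2_opNorm_mulVec y (WithLp.toLp 2 fun i => v (Fin.natAdd m i))).trans
      (mul_le_mul_of_nonneg_right (le_max_right ‖x‖ ‖y‖) (norm_nonneg _))
    have h3 := sq_norm_append (fun i => v (Fin.castAdd n i)) (fun i => v (Fin.natAdd m i))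
    rw [Fin.append_castAdd_natAdd] at h3
    rw [key, mul_pow, h3, mul_add, ← mul_pow, ← mul_pow]
    exact add_le_add (pow_le_pow_left₀ (norm_nonneg _) h1 2)
      (pow_le_pow_left₀ (norm_nonneg _) h2 2)
  · refine l2_norm_le_of_mulVec _ _ (norm_nonneg _) fun u => ?_
    have h1 := Matrix.l2_opNorm_mulVec (matrixDirectSum x y)
      (WithLp.toLp 2 (Fin.append u (0 : Fin n → ℂ)))
    have h2 : ‖WithLp.toLp 2 (Fin.append u (0 : Fin n → ℂ))‖ = ‖WithLp.toLp 2 u‖ := by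
      rw [← sq_eq_sq₀ (norm_nonneg _) (norm_nonneg _), sq_norm_append]; simp
    have h3 := key (Fin.append u 0)
    simp only [Fin.append_left, Fin.append_right] at h3
    rw [h2] at h1
    refine le_trans (le_of_sq_le_sq ?_ (norm_nonneg _)) h1
    exact (le_add_of_nonneg_right (sq_nonneg _)).trans_eq h3.symm
  · refine l2_norm_le_of_mulVec _ _ (norm_nonneg _) fun u => ?_
    have h1 := Matrix.l2_opNorm_mulVec (matrixDirectSum x y)
      (WithLp.toLp 2 (Fin.append (0 : Fin m → ℂ) u))
    have h2 : ‖WithLp.toLp 2 (Fin.append (0 : Fin m → ℂ) u)‖ = ‖WithLp.toLp 2 u‖ := by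
      rw [← sq_eq_sq₀ (norm_nonneg _) (norm_nonneg _), sq_norm_append]; simp
    have h3 := key (Fin.append 0 u)
    simp only [Fin.append_left, Fin.append_right] at h3
    rw [h2] at h1
    refine le_trans (le_of_sq_le_sq ?_ (norm_nonneg _)) h1
    exact (le_add_of_nonneg_left (sq_nonneg _)).trans_eq h3.symm

/-- The one-dimensional operator space `ℂ1`: the vector space `ℂ` with the operator norm on each
`M_n(ℂ)`. -/
noncomputable def oneDimOperatorSpace : OperatorSpace ℂ where
  matNorm n := normSeminorm ℂ (Matrix (Fin n) (Fin n) ℂ)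
  eq_zero_of_matNorm_eq_zero _ x h := by simpa using h
  matNorm_directSum _ _ x y := l2_norm_matrixDirectSum x y
  matNorm_sandwich_le _ _ a x b := by
    rw [scalarSandwich_complex]
    exact (Matrix.l2_opNorm_mul _ _).trans
      (mul_le_mul_of_nonneg_right (Matrix.l2_opNorm_mul _ _) (norm_nonneg _))

/-! One inequality is Cauchy-Schwarz and AM-GM: `matrixNumericalRadius_mul_mul_le` bounds w(ayb) for
an inner dimension of any size. The substance is the converse, Ando's factorization α = 2(1 -
C*C)^{1/2} C when w(α) ≤ 1.

For w(α) < 1, averaging over roots of unity makes the block Toeplitz matrices with 2 on the diagonal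
and α next to it uniformly positive. Their successive Schur complements decrease and stay bounded
below, so they converge to an invertible solution of X = 2 - α* X⁻¹ α (`exists_posDef_eq_sub_inv`).
Then D = (X/2)^{1/2} and C = ½ D⁻¹ α satisfy D² = 1 - C*C and α = 2DC; compactness gives the case
w(α) = 1.

From C, the choice A = 1 - 2C*C gives the block matrix directly and the form (1+A)^{1/2} B
(1-A)^{1/2} by polar decomposition. The outer factors of the latter have value ½‖2‖ = 1, so
rescaling yields square factorizations with value arbitrarily close to w(α). Both infimum formulas
follow. -/

/-! ### Quadratic forms and the numerical radius -/

theorem sq_norm_toLp {m : Type*} [Fintype m] (v : m → ℂ) :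
    ‖WithLp.toLp 2 v‖ ^ 2 = (star v ⬝ᵥ v).re := by
  rw [EuclideanSpace.norm_sq_eq, dotProduct, Complex.re_sum]
  refine Finset.sum_congr rfl fun i _ => ?_
  simp [Complex.sq_norm, Complex.normSq_apply]

theorem dotProduct_star_self_re_nonneg {m : Type*} [Fintype m] (v : m → ℂ) :
    0 ≤ (star v ⬝ᵥ v).re := by
  rw [← sq_norm_toLp]; positivity

theorem norm_dotProduct_mulVec_le_matrixNumericalRadius {n : ℕ} (α : Matrix (Fin n) (Fin n) ℂ)
    (v : Fin n → ℂ) :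
    ‖star v ⬝ᵥ α *ᵥ v‖ ≤ matrixNumericalRadius α * (star v ⬝ᵥ v).re := by
  have hinner : ∀ ξ : EuclideanSpace ℂ (Fin n),
      inner ℂ ξ (Matrix.toEuclideanCLM (n := Fin n) (𝕜 := ℂ) α ξ) =
        star ξ.ofLp ⬝ᵥ α *ᵥ ξ.ofLp := fun ξ => by
    rw [EuclideanSpace.inner_eq_star_dotProduct, Matrix.ofLp_toEuclideanCLM, dotProduct_comm]
  -- Without boundedness the real `sSup` would default to 0 and bound nothing.
  have hbdd : BddAbove {t : ℝ | ∃ ξ : EuclideanSpace ℂ (Fin n), ‖ξ‖ = 1 ∧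
      t = ‖inner ℂ ξ (Matrix.toEuclideanCLM (n := Fin n) (𝕜 := ℂ) α ξ)‖} := by
    refine ⟨‖Matrix.toEuclideanCLM (n := Fin n) (𝕜 := ℂ) α‖, ?_⟩
    rintro t ⟨ξ, hξ, rfl⟩
    refine (norm_inner_le_norm _ _).trans ?_
    have := (Matrix.toEuclideanCLM (n := Fin n) (𝕜 := ℂ) α).le_opNorm ξ
    rw [hξ] at this ⊢
    linarith
  rcases eq_or_ne v 0 with rfl | hv
  · simp
  have hn : 0 < ‖WithLp.toLp 2 v‖ := by simpa using hv
  set c : ℝ := ‖WithLp.toLp 2 v‖ with hc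
  have h1 : ‖inner ℂ (((c⁻¹ : ℝ) : ℂ) • WithLp.toLp 2 v)
      (Matrix.toEuclideanCLM (n := Fin n) (𝕜 := ℂ) α (((c⁻¹ : ℝ) : ℂ) • WithLp.toLp 2 v))‖ ≤
      matrixNumericalRadius α := by
    refine le_csSup hbdd ⟨_, ?_, rfl⟩
    rw [norm_smul, Complex.norm_real, norm_inv, norm_norm, inv_mul_cancel₀ hn.ne']
  rw [map_smul, inner_smul_left, inner_smul_right, hinner, norm_mul, norm_mul] at h1
  simp only [RCLike.norm_conj, Complex.norm_real, norm_inv, hc, norm_norm] at h1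
  rw [← hc] at h1
  rw [← sq_norm_toLp, ← hc]
  have h2 : ‖star v ⬝ᵥ α *ᵥ v‖ = (c⁻¹ * (c⁻¹ * ‖star v ⬝ᵥ α *ᵥ v‖)) * c ^ 2 := by
    field_simp
  rw [h2]
  exact mul_le_mul_of_nonneg_right h1 (sq_nonneg _)

theorem matrixNumericalRadius_le {n : ℕ} {α : Matrix (Fin n) (Fin n) ℂ} {c : ℝ} (hc : 0 ≤ c)
    (h : ∀ v : Fin n → ℂ, ‖star v ⬝ᵥ α *ᵥ v‖ ≤ c * (star v ⬝ᵥ v).re) :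
    matrixNumericalRadius α ≤ c := by
  -- For n = 0 there are no unit vectors and the supremum is the default 0, which is where `hc`
  -- matters.
  refine Real.sSup_le ?_ hc
  rintro t ⟨ξ, hξ, rfl⟩
  rw [EuclideanSpace.inner_eq_star_dotProduct, Matrix.ofLp_toEuclideanCLM, dotProduct_comm]
  refine (h ξ.ofLp).trans ?_
  rw [← sq_norm_toLp, WithLp.toLp_ofLp, hξ]
  simp

theorem matrixNumericalRadius_nonneg {n : ℕ} (α : Matrix (Fin n) (Fin n) ℂ) :
    0 ≤ matrixNumericalRadius α := by
  refine Real.sSup_nonneg ?_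
  rintro t ⟨ξ, -, rfl⟩
  exact norm_nonneg _

theorem dotProduct_mulVec_re_le {m : Type*} [Fintype m] [DecidableEq m] (M : Matrix m m ℂ)
    (v : m → ℂ) : (star v ⬝ᵥ M *ᵥ v).re ≤ ‖M‖ * (star v ⬝ᵥ v).re := by
  have h1 := norm_inner_le_norm (𝕜 := ℂ) (WithLp.toLp 2 v) (WithLp.toLp 2 (M *ᵥ v))
  have h2 := Matrix.l2_opNorm_mulVec M (WithLp.toLp 2 v)
  rw [EuclideanSpace.inner_eq_star_dotProduct, dotProduct_comm] at h1
  rw [← sq_norm_toLp, sq]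
  calc (star v ⬝ᵥ M *ᵥ v).re ≤ ‖star v ⬝ᵥ M *ᵥ v‖ := Complex.re_le_norm _
    _ ≤ _ := h1
    _ ≤ ‖WithLp.toLp 2 v‖ * (‖M‖ * ‖WithLp.toLp 2 v‖) :=
      mul_le_mul_of_nonneg_left h2 (norm_nonneg _)
    _ = _ := by ring

/-- A factorization `α = a y b` through a contraction bounds the numerical radius of `α`. -/
theorem matrixNumericalRadius_mul_mul_le {n r : ℕ} (a : Matrix (Fin n) (Fin r) ℂ)
    (y : Matrix (Fin r) (Fin r) ℂ) (b : Matrix (Fin r) (Fin n) ℂ) (hy : ‖y‖ ≤ 1) :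
    matrixNumericalRadius (a * y * b) ≤ 1 / 2 * ‖a * aᴴ + bᴴ * b‖ := by
  refine matrixNumericalRadius_le (by positivity) fun v => ?_
  have h0 : star v ⬝ᵥ (a * y * b) *ᵥ v = star (aᴴ *ᵥ v) ⬝ᵥ (y *ᵥ (b *ᵥ v)) := by
    rw [Matrix.star_mulVec, Matrix.conjTranspose_conjTranspose, Matrix.mulVec_mulVec,
      ← Matrix.dotProduct_mulVec, Matrix.mulVec_mulVec, Matrix.mul_assoc]
  have h1 := norm_inner_le_norm (𝕜 := ℂ) (WithLp.toLp 2 (aᴴ *ᵥ v)) (WithLp.toLp 2 (y *ᵥ (b *ᵥ v)))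
  have h2 := Matrix.l2_opNorm_mulVec y (WithLp.toLp 2 (b *ᵥ v))
  rw [EuclideanSpace.inner_eq_star_dotProduct, dotProduct_comm] at h1
  have h3 : ‖WithLp.toLp 2 (y *ᵥ (b *ᵥ v))‖ ≤ ‖WithLp.toLp 2 (b *ᵥ v)‖ :=
    h2.trans (mul_le_of_le_one_left (norm_nonneg _) hy)
  have h4 : ‖star v ⬝ᵥ (a * y * b) *ᵥ v‖ ≤
      ‖WithLp.toLp 2 (aᴴ *ᵥ v)‖ * ‖WithLp.toLp 2 (b *ᵥ v)‖ := by
    rw [h0]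
    exact h1.trans (mul_le_mul_of_nonneg_left h3 (norm_nonneg _))
  have h5 := dotProduct_mulVec_re_le (a * aᴴ + bᴴ * b) v
  have h6 : (star v ⬝ᵥ (a * aᴴ + bᴴ * b) *ᵥ v).re =
      ‖WithLp.toLp 2 (aᴴ *ᵥ v)‖ ^ 2 + ‖WithLp.toLp 2 (b *ᵥ v)‖ ^ 2 := by
    rw [sq_norm_toLp, sq_norm_toLp, Matrix.star_mulVec, Matrix.star_mulVec,
      Matrix.conjTranspose_conjTranspose, ← Matrix.dotProduct_mulVec, ← Matrix.dotProduct_mulVec,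
      Matrix.mulVec_mulVec, Matrix.mulVec_mulVec, Matrix.add_mulVec, dotProduct_add,
      Complex.add_re]
  rw [h6] at h5
  nlinarith [sq_nonneg (‖WithLp.toLp 2 (aᴴ *ᵥ v)‖ - ‖WithLp.toLp 2 (b *ᵥ v)‖)]

/-! ### Averaging over roots of unity -/

/-- Orthogonality of characters: after expansion the pair (i, j) carries the weight ∑ₓ χ(x(j - i -
c)), which is N if j = i + c and 0 otherwise. -/
theorem sum_stdAddChar_mul_dotProduct {N : ℕ} [NeZero N] {m : Type*} [Fintype m]
    (M : Matrix m m ℂ) (v : ZMod N → m → ℂ) (c : ZMod N) :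
    ∑ x : ZMod N, ZMod.stdAddChar (-(x * c)) *
        (star (∑ i, ZMod.stdAddChar (x * i) • v i) ⬝ᵥ
          M *ᵥ (∑ j, ZMod.stdAddChar (x * j) • v j)) =
      N * ∑ i, star (v i) ⬝ᵥ M *ᵥ v (i + c) := by
  have h1 : ∀ x : ZMod N, ZMod.stdAddChar (-(x * c)) *
        (star (∑ i, ZMod.stdAddChar (x * i) • v i) ⬝ᵥ
          M *ᵥ (∑ j, ZMod.stdAddChar (x * j) • v j)) =
      ∑ i, ∑ j, ZMod.stdAddChar (x * (j - (i + c))) * (star (v i) ⬝ᵥ M *ᵥ v j) := fun x => by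
    rw [star_sum, sum_dotProduct, Finset.mul_sum]
    refine Finset.sum_congr rfl fun i _ => ?_
    rw [Matrix.mulVec_sum, dotProduct_sum, Finset.mul_sum]
    refine Finset.sum_congr rfl fun j _ => ?_
    have h2 : ZMod.stdAddChar (x * (j - (i + c))) = ZMod.stdAddChar (-(x * c)) *
        (star (ZMod.stdAddChar (x * i)) * ZMod.stdAddChar (x * j) : ℂ) := by
      rw [show star (ZMod.stdAddChar (x * i) : ℂ) = ZMod.stdAddChar (-(x * i)) from
        (AddChar.map_neg_eq_conj _ _).symm, ← AddChar.map_add_eq_mul, ← AddChar.map_add_eq_mul]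
      congr 1
      ring
    rw [h2, star_smul, smul_dotProduct, Matrix.mulVec_smul, dotProduct_smul]
    simp only [smul_eq_mul]
    ring
  simp_rw [h1]
  rw [Finset.sum_comm, Finset.mul_sum]
  refine Finset.sum_congr rfl fun i _ => ?_
  rw [Finset.sum_comm]
  simp_rw [← Finset.sum_mul, AddChar.sum_mulShift _ (ZMod.isPrimitive_stdAddChar N), sub_eq_zero]
  simp [ZMod.card]

/-- The block circulant matrix with symbol `α z` is bounded by the numerical radius of `α`. -/
theorem norm_sum_cyclic_shift_le {N : ℕ} [NeZero N] {m : Type*} [Fintype m]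
    {M : Matrix m m ℂ} {ρ : ℝ} (h : ∀ v, ‖star v ⬝ᵥ M *ᵥ v‖ ≤ ρ * (star v ⬝ᵥ v).re)
    (v : ZMod N → m → ℂ) :
    ‖∑ i, star (v i) ⬝ᵥ M *ᵥ v (i + 1)‖ ≤ ρ * ∑ i, (star (v i) ⬝ᵥ v i).re := by
  classical
  -- The shift c = 1 isolates the cyclic sum; c = 0 with the identity matrix is Parseval for the
  -- right-hand side.
  have h1 := sum_stdAddChar_mul_dotProduct M v 1
  have h2 := sum_stdAddChar_mul_dotProduct 1 v 0
  simp only [mul_zero, neg_zero, AddChar.map_zero_eq_one, one_mul, add_zero,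
    Matrix.one_mulVec] at h2
  have h3 := congrArg Complex.re h2
  rw [Complex.re_sum, ← Complex.ofReal_natCast, Complex.re_ofReal_mul, Complex.re_sum] at h3
  have hN : (0 : ℝ) < N := by exact_mod_cast Nat.pos_of_ne_zero (NeZero.ne N)
  refine le_of_mul_le_mul_left ?_ hN
  calc (N : ℝ) * ‖∑ i, star (v i) ⬝ᵥ M *ᵥ v (i + 1)‖
      = ‖(N : ℂ) * ∑ i, star (v i) ⬝ᵥ M *ᵥ v (i + 1)‖ := by simp
    _ ≤ ∑ x : ZMod N, ρ * (star (∑ i, ZMod.stdAddChar (x * i) • v i) ⬝ᵥ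
          (∑ j, ZMod.stdAddChar (x * j) • v j) : ℂ).re := by
        rw [← h1]
        refine norm_sum_le_of_le _ fun x _ => ?_
        rw [norm_mul, AddChar.norm_apply, one_mul]
        exact h _
    _ = _ := by rw [← Finset.mul_sum, h3]; ring

theorem norm_sum_shift_le {m : Type*} [Fintype m]
    {M : Matrix m m ℂ} {ρ : ℝ} (h : ∀ v, ‖star v ⬝ᵥ M *ᵥ v‖ ≤ ρ * (star v ⬝ᵥ v).re)
    (k : ℕ) (v : ℕ → m → ℂ) :
    ‖∑ i ∈ Finset.range k, star (v i) ⬝ᵥ M *ᵥ v (i + 1)‖ ≤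
      ρ * ∑ i ∈ Finset.range (k + 1), (star (v i) ⬝ᵥ v i).re := by
  -- One extra site carrying the zero vector, hence k + 2 sites in all, kills the wrap-around terms.
  have key := norm_sum_cyclic_shift_le (N := k + 2) h
    (fun i => if i.val ≤ k then v i.val else 0)
  have e1 : ∑ i : ZMod (k + 2), (star (if i.val ≤ k then v i.val else 0) ⬝ᵥ
      (if i.val ≤ k then v i.val else 0)).re =
      ∑ i ∈ Finset.range (k + 1), (star (v i) ⬝ᵥ v i).re := by
    refine (Fin.sum_univ_eq_sum_range (fun i => (star (if i ≤ k then v i else 0) ⬝ᵥ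
      (if i ≤ k then v i else 0)).re) (k + 2)).trans ?_
    rw [Finset.sum_range_succ]
    simp only [show ¬ (k + 1 ≤ k) by omega, if_false, dotProduct_zero, Complex.zero_re, add_zero]
    refine Finset.sum_congr rfl fun i hi => ?_
    rw [if_pos (Nat.lt_succ_iff.mp (Finset.mem_range.mp hi))]
  have e2 : ∑ i : ZMod (k + 2), (star (if i.val ≤ k then v i.val else 0) ⬝ᵥ M *ᵥ
      (if (i + 1).val ≤ k then v (i + 1).val else 0)) =
      ∑ i ∈ Finset.range k, star (v i) ⬝ᵥ M *ᵥ v (i + 1) := by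
    have : Fact (1 < k + 2) := ⟨by omega⟩
    have e3 : ∀ i : ZMod (k + 2), (star (if i.val ≤ k then v i.val else 0) ⬝ᵥ M *ᵥ
      (if (i + 1).val ≤ k then v (i + 1).val else 0)) =
        if i.val < k then star (v i.val) ⬝ᵥ M *ᵥ v (i.val + 1) else 0 := fun i => by
      by_cases hi : i.val ≤ k
      · have hs : (i + 1).val = i.val + 1 := by
          rw [ZMod.val_add_of_lt] <;> rw [ZMod.val_one]
          omega
        rw [hs, if_pos hi]
        by_cases hk : i.val < k
        · rw [if_pos (by omega : i.val + 1 ≤ k), if_pos hk]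
        · rw [if_neg (by omega : ¬ i.val + 1 ≤ k), if_neg hk, Matrix.mulVec_zero, dotProduct_zero]
      · rw [if_neg hi, if_neg (by omega : ¬ i.val < k), star_zero, zero_dotProduct]
    rw [Finset.sum_congr rfl fun i _ => e3 i]
    refine (Fin.sum_univ_eq_sum_range (fun i => if i < k then
      star (v i) ⬝ᵥ M *ᵥ v (i + 1) else 0) (k + 2)).trans ?_
    rw [Finset.sum_range_succ, Finset.sum_range_succ, if_neg (by omega), if_neg (by omega),
      add_zero, add_zero]
    refine Finset.sum_congr rfl fun i hi => if_pos (Finset.mem_range.mp hi)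
  rw [e1, e2] at key
  exact key

/-! ### Schur complements and the equation X = 2 - α* X⁻¹ α -/

theorem Matrix.IsHermitian.posSemidef_of_re_nonneg {m : Type*} [Fintype m] {M : Matrix m m ℂ}
    (hM : M.IsHermitian) (h : ∀ v, 0 ≤ (star v ⬝ᵥ M *ᵥ v).re) : M.PosSemidef :=
  .of_dotProduct_mulVec_nonneg hM fun v => Complex.nonneg_iff.mpr
    ⟨h v, (hM.im_star_dotProduct_mulVec_self v).symm⟩

theorem Matrix.IsHermitian.posDef_of_re_pos {m : Type*} [Fintype m] {M : Matrix m m ℂ}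
    (hM : M.IsHermitian) (h : ∀ v, v ≠ 0 → 0 < (star v ⬝ᵥ M *ᵥ v).re) : M.PosDef :=
  .of_dotProduct_mulVec_pos hM fun v hv => Complex.pos_iff.mpr
    ⟨h v hv, (hM.im_star_dotProduct_mulVec_self v).symm⟩

theorem Matrix.PosDef.inv_le_inv {m : Type*} [Fintype m] [DecidableEq m] {A B : Matrix m m ℂ}
    (hA : A.PosDef) (hB : B.PosDef) (h : A ≤ B) : B⁻¹ ≤ A⁻¹ := by
  have := CStarAlgebra.inv_le_inv (a := hA.isUnit.unit) (b := hB.isUnit.unit)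
    (Matrix.nonneg_iff_posSemidef.mpr hA.posSemidef) h
  simpa [Matrix.coe_units_inv] using this

/-- The iteration `X ↦ 2 - α* X⁻¹ α` started at `2`: the Schur complements of the block Toeplitz
matrices with symbol `2 + 2 Re (α z)`. -/
noncomputable def schurIterate {n : ℕ} (α : Matrix (Fin n) (Fin n) ℂ) :
    ℕ → Matrix (Fin n) (Fin n) ℂ
  | 0 => 2
  | k + 1 => 2 - αᴴ * (schurIterate α k)⁻¹ * α

/-- The quadratic form of the block Toeplitz matrix with symbol `2 + 2 Re (α z)`. -/
noncomputable def toeplitzForm {n : ℕ} (α : Matrix (Fin n) (Fin n) ℂ) (k : ℕ)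
    (v : ℕ → Fin n → ℂ) : ℝ :=
  2 * ∑ i ∈ Finset.range (k + 1), (star (v i) ⬝ᵥ v i).re +
    2 * (∑ i ∈ Finset.range k, star (v i) ⬝ᵥ α *ᵥ v (i + 1)).re

/-- The off-diagonal part costs at most 2ρ times the total squared norm, and of what remains only
the last site is kept. The bound does not depend on k. -/
theorem le_toeplitzForm {n : ℕ} {α : Matrix (Fin n) (Fin n) ℂ} {ρ : ℝ} (hρ : ρ ≤ 1)
    (h : ∀ v, ‖star v ⬝ᵥ α *ᵥ v‖ ≤ ρ * (star v ⬝ᵥ v).re) (k : ℕ) (v : ℕ → Fin n → ℂ) :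
    2 * (1 - ρ) * (star (v k) ⬝ᵥ v k).re ≤ toeplitzForm α k v := by
  have h1 := norm_sum_shift_le h k v
  have h2 := (abs_le.mp (Complex.abs_re_le_norm
    (∑ i ∈ Finset.range k, star (v i) ⬝ᵥ α *ᵥ v (i + 1)))).1
  have h3 : (star (v k) ⬝ᵥ v k).re ≤ ∑ i ∈ Finset.range (k + 1), (star (v i) ⬝ᵥ v i).re :=
    Finset.single_le_sum (f := fun i => (star (v i) ⬝ᵥ v i).re)
      (fun i _ => dotProduct_star_self_re_nonneg (v i)) (by simp)
  rw [toeplitzForm]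
  nlinarith [mul_le_mul_of_nonneg_left h3 (by linarith : 0 ≤ 1 - ρ)]

theorem toeplitzForm_update {n : ℕ} (α : Matrix (Fin n) (Fin n) ℂ) (k : ℕ)
    (v : ℕ → Fin n → ℂ) (ξ : Fin n → ℂ) :
    toeplitzForm α (k + 1) (Function.update v (k + 1) ξ) =
      toeplitzForm α k v + 2 * (star ξ ⬝ᵥ ξ).re + 2 * (star (v k) ⬝ᵥ α *ᵥ ξ).re := by
  have e : ∀ i, i ≤ k → Function.update v (k + 1) ξ i = v i := fun i hi =>
    Function.update_of_ne (by omega) _ _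
  have e1 : ∑ i ∈ Finset.range (k + 1), (star (Function.update v (k + 1) ξ i) ⬝ᵥ
      Function.update v (k + 1) ξ i).re = ∑ i ∈ Finset.range (k + 1), (star (v i) ⬝ᵥ v i).re :=
    Finset.sum_congr rfl fun i hi => by rw [e i (Nat.lt_succ_iff.mp (Finset.mem_range.mp hi))]
  have e2 : ∑ i ∈ Finset.range k, star (Function.update v (k + 1) ξ i) ⬝ᵥ α *ᵥ
      Function.update v (k + 1) ξ (i + 1) = ∑ i ∈ Finset.range k, star (v i) ⬝ᵥ α *ᵥ v (i + 1) :=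
    Finset.sum_congr rfl fun i hi => by
      rw [e i (Finset.mem_range.mp hi).le, e (i + 1) (Finset.mem_range.mp hi)]
  rw [toeplitzForm, toeplitzForm, Finset.sum_range_succ _ (k + 1), e1,
    Finset.sum_range_succ (fun i => star (Function.update v (k + 1) ξ i) ⬝ᵥ α *ᵥ
      Function.update v (k + 1) ξ (i + 1)) k, e2, Function.update_self, e k le_rfl, Complex.add_re]
  ring

/-- The Schur complement is the Toeplitz form with all sites but the last eliminated. Only
attainment of its value is needed: with `le_toeplitzForm` it gives positivity. The two claims are
proved together, since extending the vector requires the previous iterate to be invertible. -/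
theorem schurIterate_posDef_and_exists {n : ℕ} {α : Matrix (Fin n) (Fin n) ℂ} {ρ : ℝ} (hρ : ρ < 1)
    (h : ∀ v, ‖star v ⬝ᵥ α *ᵥ v‖ ≤ ρ * (star v ⬝ᵥ v).re) (k : ℕ) :
    (schurIterate α k).PosDef ∧ ∀ ξ, ∃ v : ℕ → Fin n → ℂ, v k = ξ ∧
      toeplitzForm α k v = (star ξ ⬝ᵥ schurIterate α k *ᵥ ξ).re := by
  induction k with
  | zero =>
    refine ⟨?_, fun ξ => ⟨fun _ => ξ, rfl, ?_⟩⟩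
    · exact Matrix.PosDef.ofNat 2
    · simp [toeplitzForm, schurIterate, Matrix.ofNat_mulVec]
  | succ k ih =>
    obtain ⟨hX, hv⟩ := ih
    have hex : ∀ ξ, ∃ v : ℕ → Fin n → ℂ, v (k + 1) = ξ ∧
        toeplitzForm α (k + 1) v = (star ξ ⬝ᵥ schurIterate α (k + 1) *ᵥ ξ).re := fun ξ => by
      -- Completing the square: this value at site k minimizes ⟨u, Xₖ u⟩ + 2 Re ⟨u, αξ⟩ over u.
      obtain ⟨v, hvk, hform⟩ := hv (-((schurIterate α k)⁻¹ *ᵥ (α *ᵥ ξ)))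
      refine ⟨Function.update v (k + 1) ξ, Function.update_self _ _ _, ?_⟩
      rw [toeplitzForm_update, hform, hvk, schurIterate]
      have h1 : schurIterate α k *ᵥ ((schurIterate α k)⁻¹ *ᵥ (α *ᵥ ξ)) = α *ᵥ ξ := by
        rw [Matrix.mulVec_mulVec, Matrix.mul_nonsing_inv _
          ((Matrix.isUnit_iff_isUnit_det _).mp hX.isUnit), Matrix.one_mulVec]
      have h2 : star ξ ⬝ᵥ (αᴴ * (schurIterate α k)⁻¹ * α) *ᵥ ξ =
          star ((schurIterate α k)⁻¹ *ᵥ (α *ᵥ ξ)) ⬝ᵥ (α *ᵥ ξ) := by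
        rw [Matrix.star_mulVec, Matrix.star_mulVec, hX.inv.isHermitian.eq,
          ← Matrix.dotProduct_mulVec, ← Matrix.dotProduct_mulVec, Matrix.mulVec_mulVec,
          Matrix.mulVec_mulVec, Matrix.mul_assoc]
      rw [Matrix.sub_mulVec, dotProduct_sub, h2, Matrix.mulVec_neg, h1, star_neg, neg_dotProduct,
        dotProduct_neg, neg_neg, neg_dotProduct, Complex.neg_re, Complex.sub_re]
      have h3 : (star ξ ⬝ᵥ (2 : Matrix (Fin n) (Fin n) ℂ) *ᵥ ξ).re = 2 * (star ξ ⬝ᵥ ξ).re := by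
        simp [Matrix.ofNat_mulVec]
      rw [h3]
      ring
    refine ⟨Matrix.IsHermitian.posDef_of_re_pos ?_ fun ξ hξ => ?_, hex⟩
    · rw [schurIterate]
      exact (Matrix.PosDef.ofNat 2).isHermitian.sub
        (Matrix.isHermitian_conjTranspose_mul_mul α hX.inv.isHermitian)
    · obtain ⟨v, hvk, hform⟩ := hex ξ
      have h1 := le_toeplitzForm hρ.le h (k + 1) v
      rw [hform, hvk] at h1
      refine lt_of_lt_of_le ?_ h1
      have : 0 < ‖WithLp.toLp 2 ξ‖ := by simpa using hξ
      rw [← sq_norm_toLp]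
      have : 0 < 1 - ρ := by linarith
      positivity

theorem schurIterate_posDef {n : ℕ} {α : Matrix (Fin n) (Fin n) ℂ} {ρ : ℝ} (hρ : ρ < 1)
    (h : ∀ v, ‖star v ⬝ᵥ α *ᵥ v‖ ≤ ρ * (star v ⬝ᵥ v).re) (k : ℕ) :
    (schurIterate α k).PosDef :=
  (schurIterate_posDef_and_exists hρ h k).1

/-- This floor, uniform in k, keeps the limit of the iterates invertible. -/
theorem smul_one_le_schurIterate {n : ℕ} {α : Matrix (Fin n) (Fin n) ℂ} {ρ : ℝ} (hρ : ρ < 1)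
    (h : ∀ v, ‖star v ⬝ᵥ α *ᵥ v‖ ≤ ρ * (star v ⬝ᵥ v).re) (k : ℕ) :
    (2 * (1 - ρ)) • (1 : Matrix (Fin n) (Fin n) ℂ) ≤ schurIterate α k := by
  rw [Matrix.le_iff]
  refine Matrix.IsHermitian.posSemidef_of_re_nonneg ?_ fun ξ => ?_
  · exact (schurIterate_posDef hρ h k).isHermitian.sub
      (IsSelfAdjoint.smul (IsSelfAdjoint.all _) Matrix.isHermitian_one)
  · obtain ⟨v, hvk, hform⟩ := (schurIterate_posDef_and_exists hρ h k).2 ξ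
    have h1 := le_toeplitzForm hρ.le h k v
    rw [hform, hvk] at h1
    rw [Matrix.sub_mulVec, dotProduct_sub, Complex.sub_re, Matrix.smul_mulVec, Matrix.one_mulVec,
      dotProduct_smul, Complex.smul_re, smul_eq_mul]
    linarith

/-- Inversion reverses the order on positive definite matrices, so X ↦ 2 - α* X⁻¹ α is monotone, and
its first step goes down from 2. -/
theorem schurIterate_antitone {n : ℕ} {α : Matrix (Fin n) (Fin n) ℂ} {ρ : ℝ} (hρ : ρ < 1)
    (h : ∀ v, ‖star v ⬝ᵥ α *ᵥ v‖ ≤ ρ * (star v ⬝ᵥ v).re) : Antitone (schurIterate α) := by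
  refine antitone_nat_of_succ_le fun k => ?_
  induction k with
  | zero =>
    rw [schurIterate, schurIterate, sub_le_self_iff, schurIterate]
    exact Matrix.nonneg_iff_posSemidef.mpr
      ((Matrix.PosDef.ofNat 2).inv.posSemidef.conjTranspose_mul_mul_same α)
  | succ k ih =>
    rw [schurIterate, schurIterate]
    refine sub_le_sub_left ?_ 2
    exact star_left_conjugate_le_conjugate (Matrix.PosDef.inv_le_inv
      (schurIterate_posDef hρ h (k + 1)) (schurIterate_posDef hρ h k) ih) α

/-- If the numerical radius of `α` is less than one, then `X = 2 - α* X⁻¹ α` has a positive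
definite solution. -/
theorem exists_posDef_eq_sub_inv {n : ℕ} {α : Matrix (Fin n) (Fin n) ℂ} {ρ : ℝ} (hρ : ρ < 1)
    (h : ∀ v, ‖star v ⬝ᵥ α *ᵥ v‖ ≤ ρ * (star v ⬝ᵥ v).re) :
    ∃ X : Matrix (Fin n) (Fin n) ℂ, X.PosDef ∧ X = 2 - αᴴ * X⁻¹ * α := by
  have hpos : ∀ k, 0 ≤ schurIterate α k := fun k =>
    Matrix.nonneg_iff_posSemidef.mpr (schurIterate_posDef hρ h k).posSemidef
  have hanti := schurIterate_antitone hρ h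
  have hbound : ∀ k, schurIterate α k ∈ Metric.closedBall (0 : Matrix (Fin n) (Fin n) ℂ) 2 :=
    fun k => by
      rw [mem_closedBall_zero_iff, CStarAlgebra.norm_le_iff_le_algebraMap _ zero_le_two (hpos k)]
      refine (hanti (Nat.zero_le k)).trans_eq ?_
      rw [schurIterate, map_ofNat]
  obtain ⟨X, -, φ, hφ, hX⟩ := (isCompact_closedBall _ _).tendsto_subseq hbound
  have hc : (2 * (1 - ρ)) • (1 : Matrix (Fin n) (Fin n) ℂ) ≤ X :=
    ge_of_tendsto' hX fun k => smul_one_le_schurIterate hρ h _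
  have hXpos : X.PosDef := by
    have h1 : ((2 * (1 - ρ)) • (1 : Matrix (Fin n) (Fin n) ℂ)).PosDef :=
      Matrix.PosDef.one.smul (by linarith)
    have := h1.add_posSemidef (Matrix.le_iff.mp hc)
    rwa [add_sub_cancel] at this
  have hinv : Filter.Tendsto (fun k => (schurIterate α (φ k))⁻¹) Filter.atTop (nhds X⁻¹) := by
    simp_rw [Matrix.nonsing_inv_eq_ringInverse]
    have := NormedRing.inverse_continuousAt hXpos.isUnit.unit
    exact this.tendsto.comp hX
  have hX' : Filter.Tendsto (fun k => schurIterate α (φ k + 1)) Filter.atTop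
      (nhds (2 - αᴴ * X⁻¹ * α)) :=
    tendsto_const_nhds.sub ((tendsto_const_nhds.mul hinv).mul tendsto_const_nhds)
  refine ⟨X, hXpos, ?_⟩
  set X' := 2 - αᴴ * X⁻¹ * α
  -- X and X' are limits of a subsequence and of its shift by one. The full sequence of traces
  -- decreases and converges, so X - X' is positive semidefinite of trace 0, hence zero.
  have hle : X' ≤ X := le_of_tendsto_of_tendsto' hX' hX fun k => hanti (Nat.le_succ _)
  have htr : Continuous fun M : Matrix (Fin n) (Fin n) ℂ => M.trace.re :=
    Complex.continuous_re.comp (LinearMap.continuous_of_finiteDimensional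
      (Matrix.traceLinearMap (Fin n) ℂ ℂ))
  have htrmono : Antitone fun k => (schurIterate α k).trace.re := fun i j hij => by
    have := (Matrix.le_iff.mp (hanti hij)).trace_nonneg
    rw [Matrix.trace_sub, sub_nonneg] at this
    exact (Complex.le_def.mp this).1
  have htrlim := tendsto_atTop_ciInf htrmono ⟨0, by
    rintro _ ⟨k, rfl⟩
    exact (Complex.nonneg_iff.mp (schurIterate_posDef hρ h k).posSemidef.trace_nonneg).1⟩
  have h1 := tendsto_nhds_unique ((htr.tendsto X).comp hX) (htrlim.comp hφ.tendsto_atTop)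
  have h2 := tendsto_nhds_unique ((htr.tendsto X').comp hX')
    (htrlim.comp ((Filter.tendsto_add_atTop_nat 1).comp hφ.tendsto_atTop))
  have h3 := Matrix.le_iff.mp hle
  have h4 := Complex.nonneg_iff.mp h3.trace_nonneg
  refine sub_eq_zero.mp (h3.trace_eq_zero_iff.mp (Complex.ext ?_ h4.2.symm))
  rw [Matrix.trace_sub, Complex.sub_re, h1, h2, sub_self, Complex.zero_re]

/-! ### Ando's factorization -/

theorem norm_le_one_of_mul_self_eq_one_sub {n : ℕ} {C D : Matrix (Fin n) (Fin n) ℂ} (hD : 0 ≤ D)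
    (h : D * D = 1 - Cᴴ * C) : ‖C‖ ≤ 1 ∧ ‖D‖ ≤ 1 := by
  have hDsa : Dᴴ = D := (Matrix.nonneg_iff_posSemidef.mp hD).isHermitian.eq
  have key : ∀ E F : Matrix (Fin n) (Fin n) ℂ, Eᴴ * E + Fᴴ * F = 1 → ‖E‖ ≤ 1 := fun E F hEF => by
    have h1 : Eᴴ * E ≤ 1 := by
      rw [← hEF]
      exact le_add_of_nonneg_right
        (Matrix.nonneg_iff_posSemidef.mpr (Matrix.posSemidef_conjTranspose_mul_self F))
    have h2 : ‖Eᴴ * E‖ ≤ 1 := (CStarAlgebra.norm_le_one_iff_of_nonneg _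
      (Matrix.nonneg_iff_posSemidef.mpr (Matrix.posSemidef_conjTranspose_mul_self E))).mpr h1
    rw [Matrix.l2_opNorm_conjTranspose_mul_self] at h2
    exact abs_le_one_iff_mul_self_le_one.mpr h2 |>.trans' (le_abs_self _)
  refine ⟨key C D ?_, key D C ?_⟩ <;> rw [hDsa, h] <;> abel

/-- With D = (X/2)^{1/2} and C = ½ D⁻¹ α, the equation for X gives C*C = ½ α* X⁻¹ α = 1 - X/2 = 1 -
D². -/
theorem exists_eq_two_smul_mul_of_lt {n : ℕ} {α : Matrix (Fin n) (Fin n) ℂ} {ρ : ℝ} (hρ : ρ < 1)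
    (h : ∀ v, ‖star v ⬝ᵥ α *ᵥ v‖ ≤ ρ * (star v ⬝ᵥ v).re) :
    ∃ C D : Matrix (Fin n) (Fin n) ℂ, 0 ≤ D ∧ D * D = 1 - Cᴴ * C ∧ α = (2 : ℂ) • (D * C) := by
  obtain ⟨X, hX, hXeq⟩ := exists_posDef_eq_sub_inv hρ h
  have hY : ((1 / 2 : ℝ) • X).PosDef := hX.smul (by norm_num)
  have hY0 : 0 ≤ (1 / 2 : ℝ) • X := Matrix.nonneg_iff_posSemidef.mpr hY.posSemidef
  set D := CFC.sqrt ((1 / 2 : ℝ) • X) with hDdef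
  have hD0 : 0 ≤ D := CFC.sqrt_nonneg _
  have hDD : D * D = (1 / 2 : ℝ) • X := CFC.sqrt_mul_sqrt_self _ hY0
  have hDu : IsUnit D := (CFC.isUnit_sqrt_iff _ hY0).mpr hY.isUnit
  have hDdet := (Matrix.isUnit_iff_isUnit_det _).mp hDu
  have hDsa : Dᴴ = D := (Matrix.nonneg_iff_posSemidef.mp hD0).isHermitian.eq
  refine ⟨(1 / 2 : ℝ) • (D⁻¹ * α), D, hD0, ?_, ?_⟩
  · have h1 : D⁻¹ * D⁻¹ = (2 : ℝ) • X⁻¹ := by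
      rw [← Matrix.mul_inv_rev, hDD]
      refine Matrix.inv_eq_left_inv ?_
      rw [smul_mul_smul_comm, Matrix.nonsing_inv_mul _ ((Matrix.isUnit_iff_isUnit_det _).mp hX.isUnit)]
      norm_num
    have h2 : ((1 / 2 : ℝ) • (D⁻¹ * α))ᴴ * ((1 / 2 : ℝ) • (D⁻¹ * α)) =
        (1 / 2 : ℝ) • (αᴴ * X⁻¹ * α) := by
      rw [Matrix.conjTranspose_smul, Matrix.conjTranspose_mul, Matrix.conjTranspose_nonsing_inv,
        hDsa, smul_mul_smul_comm, Matrix.mul_assoc αᴴ, ← Matrix.mul_assoc D⁻¹, h1,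
        smul_mul_assoc, mul_smul_comm, smul_smul, Matrix.mul_assoc]
      norm_num
    rw [h2, hDD]
    have h3 : αᴴ * X⁻¹ * α = 2 - X := by rw [eq_sub_iff_add_eq', ← eq_sub_iff_add_eq]; exact hXeq
    have h4 : (1 / 2 : ℝ) • (2 : Matrix (Fin n) (Fin n) ℂ) = 1 := by
      rw [show (2 : Matrix (Fin n) (Fin n) ℂ) = (2 : ℝ) • 1 by
        rw [two_smul, one_add_one_eq_two], smul_smul]
      norm_num
    rw [h3, smul_sub, h4, sub_sub_cancel]
  · rw [mul_smul_comm, ← Matrix.mul_assoc, Matrix.mul_nonsing_inv _ hDdet, Matrix.one_mul]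
    ext i j
    simp

/-- Scaling α by 1 - 1/(m+1) reduces to the strict case. The pairs (C, D) lie in a compact set, and
their defining relations, stated without a square root, pass to limits. -/
theorem exists_eq_two_smul_mul {n : ℕ} {α : Matrix (Fin n) (Fin n) ℂ}
    (h : ∀ v, ‖star v ⬝ᵥ α *ᵥ v‖ ≤ (star v ⬝ᵥ v).re) :
    ∃ C D : Matrix (Fin n) (Fin n) ℂ, 0 ≤ D ∧ D * D = 1 - Cᴴ * C ∧ α = (2 : ℂ) • (D * C) := by
  let ρ : ℕ → ℝ := fun m => 1 - 1 / ((m : ℝ) + 1)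
  have hρ : Filter.Tendsto ρ Filter.atTop (nhds 1) := by
    simpa [ρ] using tendsto_const_nhds.sub (tendsto_one_div_add_atTop_nhds_zero_nat (𝕜 := ℝ))
  have hρ0 : ∀ m, 0 ≤ ρ m := fun m => by
    rw [sub_nonneg, div_le_one (by positivity)]
    linarith [(Nat.cast_nonneg m : (0 : ℝ) ≤ m)]
  have hρ1 : ∀ m, ρ m < 1 := fun m => sub_lt_self _ (by positivity)
  have hex : ∀ m, ∃ C D : Matrix (Fin n) (Fin n) ℂ, 0 ≤ D ∧ D * D = 1 - Cᴴ * C ∧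
      ρ m • α = (2 : ℂ) • (D * C) := fun m => by
    refine exists_eq_two_smul_mul_of_lt (hρ1 m) fun v => ?_
    rw [Matrix.smul_mulVec, dotProduct_smul, norm_smul, Real.norm_of_nonneg (hρ0 m)]
    exact mul_le_mul_of_nonneg_left (h v) (hρ0 m)
  choose C D hD hDC hα using hex
  have hmem : ∀ m, (C m, D m) ∈ Metric.closedBall (0 : Matrix (Fin n) (Fin n) ℂ) 1 ×ˢ
      Metric.closedBall (0 : Matrix (Fin n) (Fin n) ℂ) 1 := fun m => by
    simpa using norm_le_one_of_mul_self_eq_one_sub (hD m) (hDC m)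
  obtain ⟨⟨C', D'⟩, -, φ, hφ, hlim⟩ :=
    ((isCompact_closedBall _ _).prod (isCompact_closedBall _ _)).tendsto_subseq hmem
  have hC : Filter.Tendsto (fun m => C (φ m)) Filter.atTop (nhds C') := hlim.fst_nhds
  have hD' : Filter.Tendsto (fun m => D (φ m)) Filter.atTop (nhds D') := hlim.snd_nhds
  refine ⟨C', D', ge_of_tendsto' hD' fun m => hD _, ?_, ?_⟩
  · have h1 : Filter.Tendsto (fun m => D (φ m) * D (φ m)) Filter.atTop
        (nhds (1 - C'ᴴ * C')) := by
      simp_rw [hDC]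
      exact tendsto_const_nhds.sub (hC.star.mul hC)
    exact tendsto_nhds_unique (hD'.mul hD') h1
  · have h1 : Filter.Tendsto (fun m => ρ (φ m) • α) Filter.atTop (nhds ((2 : ℂ) • (D' * C'))) := by
      simp_rw [hα]
      exact (hD'.mul hC).const_smul _
    have h2 := (hρ.comp hφ.tendsto_atTop).smul_const α
    rw [one_smul] at h2
    exact tendsto_nhds_unique h2 h1

/-- Ando's factorization of a matrix whose numerical radius is at most one. -/
theorem exists_eq_two_smul_sqrt_mul {n : ℕ} {α : Matrix (Fin n) (Fin n) ℂ}
    (h : matrixNumericalRadius α ≤ 1) :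
    ∃ C : Matrix (Fin n) (Fin n) ℂ, ‖C‖ ≤ 1 ∧ α = (2 : ℂ) • (CFC.sqrt (1 - Cᴴ * C) * C) := by
  obtain ⟨C, D, hD, hDC, hα⟩ := exists_eq_two_smul_mul fun v =>
    (norm_dotProduct_mulVec_le_matrixNumericalRadius α v).trans
      (mul_le_of_le_one_left (dotProduct_star_self_re_nonneg v) h)
  refine ⟨C, (norm_le_one_of_mul_self_eq_one_sub hD hDC).1, ?_⟩
  rwa [CFC.sqrt_unique hDC hD]

/-! ### Polar decomposition and the equivalent conditions -/

/-- Every square matrix `C` is the product of a contraction and `|C|`. -/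
theorem exists_norm_le_one_eq_mul_sqrt {n : ℕ} (C : Matrix (Fin n) (Fin n) ℂ) :
    ∃ V : Matrix (Fin n) (Fin n) ℂ, ‖V‖ ≤ 1 ∧ C = V * CFC.sqrt (Cᴴ * C) := by
  set S := CFC.sqrt (Cᴴ * C) with hS
  have hCC : 0 ≤ Cᴴ * C :=
    Matrix.nonneg_iff_posSemidef.mpr (Matrix.posSemidef_conjTranspose_mul_self C)
  have hSS : Sᴴ * S = Cᴴ * C := by
    rw [(Matrix.nonneg_iff_posSemidef.mp (CFC.sqrt_nonneg (Cᴴ * C))).isHermitian.eq]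
    exact CFC.sqrt_mul_sqrt_self _ hCC
  let T := Matrix.toEuclideanCLM (n := Fin n) (𝕜 := ℂ)
  have hnorm : ∀ x, ‖T C x‖ = ‖T S x‖ := fun x => by
    have hsq : ∀ M : Matrix (Fin n) (Fin n) ℂ,
        ‖T M x‖ ^ 2 = (star x.ofLp ⬝ᵥ (Mᴴ * M) *ᵥ x.ofLp).re := fun M => by
      have := sq_norm_toLp (M *ᵥ x.ofLp)
      rw [Matrix.star_mulVec, ← Matrix.dotProduct_mulVec, Matrix.mulVec_mulVec] at this
      exact this
    rw [← sq_eq_sq₀ (norm_nonneg _) (norm_nonneg _), hsq, hsq, hSS]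
  -- `W` sends Sx to Cx and vanishes on the orthogonal complement of the range of S. The choice of
  -- the section g is harmless, because ‖Cx‖ = ‖Sx‖ makes the kernels of S and C equal.
  obtain ⟨g, hg⟩ := (T S).toLinearMap.rangeRestrict.exists_rightInverse_of_surjective
    (LinearMap.range_rangeRestrict _)
  let W : EuclideanSpace ℂ (Fin n) →L[ℂ] EuclideanSpace ℂ (Fin n) := LinearMap.toContinuousLinearMap
    ((T C).toLinearMap ∘ₗ g ∘ₗ ((T S).toLinearMap.range.orthogonalProjectionOnto).toLinearMap)
  have hgS : ∀ y : (T S).toLinearMap.range, T S (g y) = y := fun y =>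
    congrArg Subtype.val (LinearMap.congr_fun hg y)
  have hW : ∀ x, W x = T C (g ((T S).toLinearMap.range.orthogonalProjectionOnto x)) := fun _ => rfl
  refine ⟨T.symm W, ?_, ?_⟩
  · rw [← Matrix.l2_opNorm_toEuclideanCLM]
    refine ContinuousLinearMap.opNorm_le_bound _ zero_le_one fun x => ?_
    change ‖T (T.symm W) x‖ ≤ _
    rw [StarAlgEquiv.apply_symm_apply, hW, hnorm, hgS, one_mul]
    exact Submodule.norm_orthogonalProjectionOnto_apply_le _ x
  · refine EquivLike.injective T ?_
    rw [map_mul, StarAlgEquiv.apply_symm_apply]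
    ext1 x
    change T C x = W (T S x)
    rw [hW, Submodule.orthogonalProjectionOnto_mem_subspace_eq_self
      (⟨T S x, x, rfl⟩ : (T S).toLinearMap.range), ← sub_eq_zero,
      ← map_sub, ← norm_eq_zero, hnorm, map_sub, hgS, sub_self, norm_zero]

theorem matrixNumericalRadius_le_one_of_fromBlocks_posSemidef {n : ℕ}
    {α A : Matrix (Fin n) (Fin n) ℂ}
    (h : (Matrix.fromBlocks (1 + A) α αᴴ (1 - A)).PosSemidef) : matrixNumericalRadius α ≤ 1 := by
  refine matrixNumericalRadius_le zero_le_one fun v => ?_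
  -- The phase z turns both cross terms into -|⟨v, αv⟩| when the block matrix is tested on (zv, v);
  -- since |z| = 1, the two contributions of A cancel.
  obtain ⟨z, hz, hzw⟩ : ∃ z : ℂ, ‖z‖ = 1 ∧ star z * (star v ⬝ᵥ α *ᵥ v) = -‖star v ⬝ᵥ α *ᵥ v‖ := by
    set w := star v ⬝ᵥ α *ᵥ v
    rcases eq_or_ne w 0 with hw | hw
    · exact ⟨1, by simp [hw]⟩
    · have hw' : (‖w‖ : ℂ) ≠ 0 := by simpa using hw
      refine ⟨-(w / ‖w‖), by simp [hw], ?_⟩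
      have h1 : star w * w = (‖w‖ : ℂ) ^ 2 := Complex.conj_mul' w
      have h2 : star (-(w / ‖w‖)) = -(star w / ‖w‖) := by simp
      rw [h2, neg_mul, div_mul_eq_mul_div, h1]
      field_simp
  have h1 := (Complex.nonneg_iff.mp (h.dotProduct_mulVec_nonneg (Sum.elim (z • v) v))).1
  have hzz : star z * z = 1 := by
    rw [show star z * z = (‖z‖ : ℂ) ^ 2 from Complex.conj_mul' z, hz]; simp
  have h2 : star v ⬝ᵥ αᴴ *ᵥ v = star (star v ⬝ᵥ α *ᵥ v) := by
    rw [Matrix.star_dotProduct, Matrix.star_mulVec, Matrix.conjTranspose_conjTranspose,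
      ← Matrix.dotProduct_mulVec]
  have h3 : z * star (star v ⬝ᵥ α *ᵥ v) = -‖star v ⬝ᵥ α *ᵥ v‖ := by
    have := congrArg star hzw
    rw [star_mul, star_star] at this
    rw [mul_comm, this]; simp
  have h4 : star (Sum.elim (z • v) v) ⬝ᵥ
      Matrix.fromBlocks (1 + A) α αᴴ (1 - A) *ᵥ Sum.elim (z • v) v =
      (star z * z) * (star v ⬝ᵥ v + star v ⬝ᵥ A *ᵥ v) + star z * (star v ⬝ᵥ α *ᵥ v) +
        (z * (star v ⬝ᵥ αᴴ *ᵥ v) + (star v ⬝ᵥ v - star v ⬝ᵥ A *ᵥ v)) := by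
    have e : star (Sum.elim (z • v) v) = Sum.elim (star z • star v) (star v) := by
      ext i; cases i <;> simp
    rw [Matrix.fromBlocks_mulVec, e, sumElim_dotProduct_sumElim]
    simp only [Sum.elim_comp_inl, Sum.elim_comp_inr, Matrix.mulVec_smul, Matrix.add_mulVec,
      Matrix.sub_mulVec, Matrix.one_mulVec, dotProduct_add, dotProduct_sub, dotProduct_smul,
      smul_dotProduct, smul_eq_mul, smul_add]
    ring
  rw [h4, hzz, hzw, h2, h3] at h1
  simp only [Complex.add_re, Complex.sub_re, Complex.neg_re, Complex.ofReal_re, one_mul] at h1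
  linarith

theorem one_sub_conjTranspose_mul_self_nonneg {n : ℕ} {C : Matrix (Fin n) (Fin n) ℂ}
    (hC : ‖C‖ ≤ 1) : 0 ≤ 1 - Cᴴ * C := by
  have h0 : 0 ≤ Cᴴ * C :=
    Matrix.nonneg_iff_posSemidef.mpr (Matrix.posSemidef_conjTranspose_mul_self C)
  rw [sub_nonneg, ← CStarAlgebra.norm_le_one_iff_of_nonneg _ h0,
    Matrix.l2_opNorm_conjTranspose_mul_self]
  exact mul_le_one₀ hC (norm_nonneg _) hC

/-- The factors commute, so (1+A)(1-A)(1+A) + (1-A)(1+A)(1-A) = 2(1 - A²). Each summand is a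
conjugate of a positive matrix, hence A² ≤ 1. -/
theorem norm_le_one_of_nonneg {n : ℕ} {A : Matrix (Fin n) (Fin n) ℂ}
    (h1 : 0 ≤ 1 + A) (h2 : 0 ≤ 1 - A) : ‖A‖ ≤ 1 := by
  have hA : IsSelfAdjoint A := by
    simpa using (IsSelfAdjoint.of_nonneg h1).sub (IsSelfAdjoint.one _)
  have h3 : 0 ≤ (1 + A) * (1 - A) * (1 + A) + (1 - A) * (1 + A) * (1 - A) :=
    add_nonneg ((IsSelfAdjoint.of_nonneg h1).conjugate_nonneg h2)
      ((IsSelfAdjoint.of_nonneg h2).conjugate_nonneg h1)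
  have h4 : (1 / 2 : ℝ) • ((1 + A) * (1 - A) * (1 + A) + (1 - A) * (1 + A) * (1 - A)) =
      1 - A * A := by
    have : (1 + A) * (1 - A) * (1 + A) + (1 - A) * (1 + A) * (1 - A) = (2 : ℝ) • (1 - A * A) := by
      rw [two_smul]
      noncomm_ring
    rw [this, smul_smul]
    norm_num
  have h5 : 0 ≤ 1 - A * A := h4 ▸ smul_nonneg (by norm_num) h3
  have h6 : ‖A * A‖ ≤ 1 :=
    (CStarAlgebra.norm_le_one_iff_of_nonneg _ hA.mul_self_nonneg).mpr (sub_nonneg.mp h5)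
  rw [hA.norm_mul_self, sq_le_one_iff₀ (norm_nonneg _)] at h6
  exact h6

theorem Matrix.IsHermitian.one_add_nonneg_and_one_sub_nonneg {n : ℕ}
    {A : Matrix (Fin n) (Fin n) ℂ} (hA : A.IsHermitian) (h : ‖A‖ ≤ 1) :
    0 ≤ 1 + A ∧ 0 ≤ 1 - A := by
  have key : ∀ B : Matrix (Fin n) (Fin n) ℂ, IsSelfAdjoint B → ‖B‖ ≤ 1 → B ≤ 1 :=
    fun B hB hB1 => by
      refine hB.le_algebraMap_norm_self.trans ?_
      rw [← map_one (algebraMap ℝ (Matrix (Fin n) (Fin n) ℂ))]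
      exact algebraMap_mono _ hB1
  refine ⟨?_, sub_nonneg.mpr (key A hA h)⟩
  rw [← sub_neg_eq_add, sub_nonneg]
  exact key (-A) (IsSelfAdjoint.neg hA) (by rwa [norm_neg])

theorem sqrt_mul_conjTranspose_add {n : ℕ} {A : Matrix (Fin n) (Fin n) ℂ} (hA : A.IsHermitian)
    (h : ‖A‖ ≤ 1) :
    CFC.sqrt (1 + A) * (CFC.sqrt (1 + A))ᴴ + (CFC.sqrt (1 - A))ᴴ * CFC.sqrt (1 - A) = 1 + 1 := by
  obtain ⟨h1, h2⟩ := hA.one_add_nonneg_and_one_sub_nonneg h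
  rw [(Matrix.nonneg_iff_posSemidef.mp (CFC.sqrt_nonneg (1 + A))).isHermitian.eq,
    (Matrix.nonneg_iff_posSemidef.mp (CFC.sqrt_nonneg (1 - A))).isHermitian.eq,
    CFC.sqrt_mul_sqrt_self _ h1, CFC.sqrt_mul_sqrt_self _ h2]
  abel

theorem CFC.sqrt_two_smul {n : ℕ} {Y : Matrix (Fin n) (Fin n) ℂ} (hY : 0 ≤ Y) :
    CFC.sqrt ((2 : ℝ) • Y) = Real.sqrt 2 • CFC.sqrt Y := by
  refine CFC.sqrt_unique ?_ (smul_nonneg (Real.sqrt_nonneg _) (CFC.sqrt_nonneg _))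
  rw [smul_mul_smul_comm, CFC.sqrt_mul_sqrt_self _ hY, Real.mul_self_sqrt zero_le_two]

/-- Take A = 1 - 2C*C, so that 1 + A = 2(1 - C*C) and 1 - A = 2|C|², and let B be the contraction in
C = B|C|. The two factors √2 make up the 2. -/
theorem exists_sqrt_factorization {n : ℕ} {C : Matrix (Fin n) (Fin n) ℂ} (hC : ‖C‖ ≤ 1) :
    ∃ A B : Matrix (Fin n) (Fin n) ℂ, A.IsHermitian ∧ ‖A‖ ≤ 1 ∧ ‖B‖ ≤ 1 ∧
      (2 : ℂ) • (CFC.sqrt (1 - Cᴴ * C) * C) = CFC.sqrt (1 + A) * B * CFC.sqrt (1 - A) := by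
  have h0 : 0 ≤ Cᴴ * C :=
    Matrix.nonneg_iff_posSemidef.mpr (Matrix.posSemidef_conjTranspose_mul_self C)
  have h1 := one_sub_conjTranspose_mul_self_nonneg hC
  obtain ⟨V, hV, hCV⟩ := exists_norm_le_one_eq_mul_sqrt C
  have e1 : 1 + (1 - (2 : ℝ) • (Cᴴ * C)) = (2 : ℝ) • (1 - Cᴴ * C) := by
    rw [smul_sub, two_smul ℝ (1 : Matrix (Fin n) (Fin n) ℂ)]; abel
  have e2 : 1 - (1 - (2 : ℝ) • (Cᴴ * C)) = (2 : ℝ) • (Cᴴ * C) := sub_sub_cancel _ _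
  refine ⟨1 - (2 : ℝ) • (Cᴴ * C), V, ?_, norm_le_one_of_nonneg ?_ ?_, hV, ?_⟩
  · exact Matrix.isHermitian_one.sub (IsSelfAdjoint.smul (IsSelfAdjoint.all _)
      (Matrix.isHermitian_conjTranspose_mul_self C))
  · rw [e1]; exact smul_nonneg zero_le_two h1
  · rw [e2]; exact smul_nonneg zero_le_two h0
  · rw [e1, e2, CFC.sqrt_two_smul h1, CFC.sqrt_two_smul h0, smul_mul_assoc, smul_mul_smul_comm,
      Matrix.mul_assoc, ← hCV, Real.mul_self_sqrt zero_le_two]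
    ext i j
    simp

/-- With D = (1 - C*C)^{1/2}, the matrix is 2 R* R for the block row R = [D C]. -/
theorem fromBlocks_posSemidef_of_norm_le_one {n : ℕ} {C : Matrix (Fin n) (Fin n) ℂ}
    (hC : ‖C‖ ≤ 1) :
    (Matrix.fromBlocks (1 + (1 - (2 : ℂ) • (Cᴴ * C))) ((2 : ℂ) • (CFC.sqrt (1 - Cᴴ * C) * C))
      ((2 : ℂ) • (CFC.sqrt (1 - Cᴴ * C) * C))ᴴ (1 - (1 - (2 : ℂ) • (Cᴴ * C)))).PosSemidef := by
  set D := CFC.sqrt (1 - Cᴴ * C)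
  have hDD : D * D = 1 - Cᴴ * C :=
    CFC.sqrt_mul_sqrt_self _ (one_sub_conjTranspose_mul_self_nonneg hC)
  have hDsa : Dᴴ = D := (Matrix.nonneg_iff_posSemidef.mp (CFC.sqrt_nonneg _)).isHermitian.eq
  have h1 := (Matrix.posSemidef_conjTranspose_mul_self (Matrix.fromCols D C)).smul
    (zero_le_two (α := ℂ))
  rw [Matrix.conjTranspose_fromCols_eq_fromRows_conjTranspose, Matrix.fromRows_mul_fromCols,
    Matrix.fromBlocks_smul, hDsa, hDD] at h1
  convert h1 using 2
  · rw [smul_sub, two_smul ℂ (1 : Matrix (Fin n) (Fin n) ℂ)]; abel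
  · rw [Matrix.conjTranspose_smul, Matrix.conjTranspose_mul, hDsa]; simp
  · exact sub_sub_cancel _ _

theorem ando_tfae {n : ℕ} (α : Matrix (Fin n) (Fin n) ℂ) : List.TFAE [
      matrixNumericalRadius α ≤ 1,
      ∃ A B : Matrix (Fin n) (Fin n) ℂ, A.IsHermitian ∧ ‖A‖ ≤ 1 ∧ ‖B‖ ≤ 1 ∧
        α = CFC.sqrt (1 + A) * B * CFC.sqrt (1 - A),
      ∃ A : Matrix (Fin n) (Fin n) ℂ, A.IsHermitian ∧
        (Matrix.fromBlocks (1 + A) α αᴴ (1 - A)).PosSemidef,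
      ∃ C : Matrix (Fin n) (Fin n) ℂ, ‖C‖ ≤ 1 ∧
        α = (2 : ℂ) • (CFC.sqrt (1 - Cᴴ * C) * C)] := by
  tfae_have 1 → 4 := exists_eq_two_smul_sqrt_mul
  tfae_have 4 → 2 := by
    rintro ⟨C, hC, rfl⟩
    exact exists_sqrt_factorization hC
  tfae_have 4 → 3 := by
    rintro ⟨C, hC, rfl⟩
    refine ⟨1 - (2 : ℂ) • (Cᴴ * C), Matrix.isHermitian_one.sub (IsSelfAdjoint.smul ?_
      (Matrix.isHermitian_conjTranspose_mul_self C)), fromBlocks_posSemidef_of_norm_le_one hC⟩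
    exact IsSelfAdjoint.ofNat 2
  tfae_have 3 → 1 := by
    rintro ⟨A, -, hA⟩
    exact matrixNumericalRadius_le_one_of_fromBlocks_posSemidef hA
  tfae_have 2 → 1 := by
    rintro ⟨A, B, hA, hA1, hB, rfl⟩
    refine (matrixNumericalRadius_mul_mul_le _ _ _ hB).trans ?_
    rw [sqrt_mul_conjTranspose_add hA hA1]
    refine (mul_le_mul_of_nonneg_left (norm_add_le _ _) (by norm_num)).trans ?_
    have : ‖(1 : Matrix (Fin n) (Fin n) ℂ)‖ ≤ 1 :=
      (CStarAlgebra.norm_le_one_iff_of_nonneg _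
        (Matrix.nonneg_iff_posSemidef.mpr Matrix.PosSemidef.one)).mpr le_rfl
    linarith
  tfae_finish

/-! ### The infimum formulas -/

/-- For every `c > w(α)` there is a square factorization of `α` of value at most `c`. -/
theorem exists_factorization_le {n : ℕ} {α : Matrix (Fin n) (Fin n) ℂ} (hn : 0 < n) {c : ℝ}
    (hc : matrixNumericalRadius α < c) :
    ∃ β y γ : Matrix (Fin n) (Fin n) ℂ, α = β * y * γ ∧ ‖y‖ = 1 ∧
      1 / 2 * ‖β * βᴴ + γᴴ * γ‖ ≤ c := by
  have hc0 : 0 < c := (matrixNumericalRadius_nonneg α).trans_lt hc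
  have : Nonempty (Fin n) := ⟨⟨0, hn⟩⟩
  rcases eq_or_ne α 0 with rfl | hα
  · exact ⟨0, 1, 0, by simp, norm_one, by simpa using hc0.le⟩
  have hw : matrixNumericalRadius (c⁻¹ • α) ≤ 1 := by
    refine matrixNumericalRadius_le zero_le_one fun v => ?_
    rw [Matrix.smul_mulVec, dotProduct_smul, norm_smul, norm_inv, Real.norm_of_nonneg hc0.le,
      one_mul, inv_mul_le_iff₀ hc0]
    exact (norm_dotProduct_mulVec_le_matrixNumericalRadius α v).trans
      (mul_le_mul_of_nonneg_right hc.le (dotProduct_star_self_re_nonneg v))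
  obtain ⟨A, B, hA, hA1, hB, hfac⟩ := ((ando_tfae (c⁻¹ • α)).out 0 1).mp hw
  set P := CFC.sqrt (1 + A)
  set Q := CFC.sqrt (1 - A)
  have hfac' : α = c • (P * B * Q) := by rw [← hfac, smul_inv_smul₀ hc0.ne']
  have hB0 : B ≠ 0 := by
    rintro rfl
    exact hα (by simpa using hfac')
  have hB0' : 0 < ‖B‖ := norm_pos_iff.mpr hB0
  -- Normalizing B to norm one moves c‖B‖ into the outer factors, split evenly between them. The
  -- value is then at most c‖B‖ ≤ c.
  set s := Real.sqrt (c * ‖B‖)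
  have hs : s * s = c * ‖B‖ := Real.mul_self_sqrt (by positivity)
  refine ⟨s • P, ‖B‖⁻¹ • B, s • Q, ?_, ?_, ?_⟩
  · rw [smul_mul_smul_comm, smul_mul_smul_comm, hfac']
    congr 1
    rw [mul_right_comm, hs]
    field_simp
  · rw [norm_smul, norm_inv, norm_norm, inv_mul_cancel₀ hB0'.ne']
  · have e : (s • P) * (s • P)ᴴ + (s • Q)ᴴ * (s • Q) =
        (c * ‖B‖) • (1 + 1 : Matrix (Fin n) (Fin n) ℂ) := by
      rw [Matrix.conjTranspose_smul, Matrix.conjTranspose_smul, star_trivial, smul_mul_smul_comm,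
        smul_mul_smul_comm, hs, ← smul_add, sqrt_mul_conjTranspose_add hA hA1]
    rw [e, norm_smul, Real.norm_of_nonneg (by positivity)]
    have h2 : ‖(1 + 1 : Matrix (Fin n) (Fin n) ℂ)‖ ≤ 2 :=
      (norm_add_le _ _).trans (by rw [norm_one]; norm_num)
    calc 1 / 2 * (c * ‖B‖ * ‖(1 + 1 : Matrix (Fin n) (Fin n) ℂ)‖)
        ≤ 1 / 2 * (c * 1 * 2) := by gcongr
      _ = c := by ring

theorem isGLB_square_factorizations {n : ℕ} (hn : 0 < n) (α : Matrix (Fin n) (Fin n) ℂ) :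
    IsGLB {t : ℝ | ∃ β y γ : Matrix (Fin n) (Fin n) ℂ,
        α = β * y * γ ∧ ‖y‖ = 1 ∧ t = 1 / 2 * ‖β * βᴴ + γᴴ * γ‖}
      (matrixNumericalRadius α) := by
  refine ⟨?_, fun b hb => le_of_forall_gt_imp_ge_of_dense fun c hc => ?_⟩
  · rintro t ⟨β, y, γ, rfl, hy, rfl⟩
    exact matrixNumericalRadius_mul_mul_le β y γ hy.le
  · obtain ⟨β, y, γ, h1, h2, h3⟩ := exists_factorization_le hn hc
    exact (hb ⟨β, y, γ, h1, h2, rfl⟩).trans h3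

theorem wMax_oneDimOperatorSpace {n : ℕ} (hn : 0 < n) (α : Matrix (Fin n) (Fin n) ℂ) :
    oneDimOperatorSpace.wMax α = matrixNumericalRadius α := by
  have hsub : {t : ℝ | ∃ β y γ : Matrix (Fin n) (Fin n) ℂ,
        α = β * y * γ ∧ ‖y‖ = 1 ∧ t = 1 / 2 * ‖β * βᴴ + γᴴ * γ‖} ⊆
      {t : ℝ | ∃ (r : ℕ) (a : Matrix (Fin n) (Fin r) ℂ) (y : Matrix (Fin r) (Fin r) ℂ)
        (b : Matrix (Fin r) (Fin n) ℂ), α = scalarSandwich a y b ∧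
          oneDimOperatorSpace.matNorm r y = 1 ∧ t = 1 / 2 * ‖a * aᴴ + bᴴ * b‖} := by
    rintro t ⟨β, y, γ, h, hy, rfl⟩
    exact ⟨n, β, y, γ, by rw [scalarSandwich_complex, h], hy, rfl⟩
  -- Any bound above w(α) would do: this only shows that the set is nonempty, so that its `sInf` is
  -- a genuine infimum.
  obtain ⟨β, y, γ, h1, h2, -⟩ := exists_factorization_le hn (lt_add_one (matrixNumericalRadius α))
  refine IsGLB.csInf_eq ⟨?_, fun b hb => ?_⟩ ⟨_, hsub ⟨β, y, γ, h1, h2, rfl⟩⟩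
  · rintro t ⟨r, a, y, b, rfl, hy, rfl⟩
    rw [scalarSandwich_complex]
    exact matrixNumericalRadius_mul_mul_le a y b (le_of_eq hy)
  · exact (isGLB_square_factorizations hn α).2 fun t ht => hb (hsub ht)

theorem mainTheorem9 (n : ℕ) (hn : 0 < n) (α : Matrix (Fin n) (Fin n) ℂ) :
    oneDimOperatorSpace.wMax α = matrixNumericalRadius α ∧
    IsGLB {t : ℝ | ∃ β y γ : Matrix (Fin n) (Fin n) ℂ,
        α = β * y * γ ∧ ‖y‖ = 1 ∧ t = 1 / 2 * ‖β * βᴴ + γᴴ * γ‖}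
      (matrixNumericalRadius α) ∧
    List.TFAE [
      matrixNumericalRadius α ≤ 1,
      ∃ A B : Matrix (Fin n) (Fin n) ℂ, A.IsHermitian ∧ ‖A‖ ≤ 1 ∧ ‖B‖ ≤ 1 ∧
        α = CFC.sqrt (1 + A) * B * CFC.sqrt (1 - A),
      ∃ A : Matrix (Fin n) (Fin n) ℂ, A.IsHermitian ∧
        (Matrix.fromBlocks (1 + A) α αᴴ (1 - A)).PosSemidef,
      ∃ C : Matrix (Fin n) (Fin n) ℂ, ‖C‖ ≤ 1 ∧
        α = (2 : ℂ) • (CFC.sqrt (1 - Cᴴ * C) * C)] :=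
  ⟨wMax_oneDimOperatorSpace hn α, isGLB_square_factorizations hn α, ando_tfae α⟩
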